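/- Let $\theta\in(0,\pi/2]$ be a Pythagorean angle, i.e. an angle such that $\cos\theta$ and $\sin\theta$ are both rational, and write $\cos\theta=s/r$ with integers $r,s$ such that $|s|<r$ and $\gcd(r,s)=1$. For a positive integer $n$, a *rational $\theta$-parallelogram envelope for $n$* is a quintuple $(a,b,c,d,e)$ of positive rational numbers such that $$a^2+b^2-\frac{2s}{r}\,ab=c^2,\qquad a^2+d^2+\frac{2s}{r}\,ad=e^2,\qquad a(b+d)=rn .$$ Let $\mathcal N_\theta$ be the set of all positive integers $n$ for which such an envelope exists, and, for a positive rational number $m$, let $\mathcal N_{\theta,m}\subseteq\mathcal N_\theta$ be the set of all $n$ that have such an envelope with $d=mb$. Then: (i) $\mathcal N_\theta=\mathbb N$, the set of all positive integers. (ii) For every $n\in\mathcal N_\theta$ there are infinitely many distinct rational $\theta$-parallelogram envelopes for $n$. (iii) For every $n\in\mathcal N_\theta$ there are infinitely many rational numbers $m\ge 1$ such that $n\in\mathcal N_{\theta,m}$. -/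

import Mathlib

/-- `cos θ = s / r` is the expression of the cosine of `θ` in lowest terms, with `|s| < r`. -/
def IsCosineInLowestTerms (θ : ℝ) (r s : ℤ) : Prop :=
  |s| < r ∧ Int.gcd r s = 1 ∧ Real.cos θ = (s : ℝ) / (r : ℝ)

/-- A Pythagorean angle: an angle in `(0, π)` whose cosine and sine are both rational. -/
def IsPythagoreanAngle (θ : ℝ) : Prop :=
  0 < θ ∧ θ < Real.pi ∧ (∃ p : ℚ, Real.cos θ = (p : ℝ)) ∧ (∃ q : ℚ, Real.sin θ = (q : ℝ))

/-- `(a, b, c, d, e)` is a rational `θ`-parallelogram envelope for `n`.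
The integers `r`, `s` are uniquely determined by `θ`. -/
def IsParallelogramEnvelope (θ : ℝ) (n : ℕ) (a b c d e : ℚ) : Prop :=
  0 < n ∧ 0 < a ∧ 0 < b ∧ 0 < c ∧ 0 < d ∧ 0 < e ∧
    ∃ r s : ℤ, IsCosineInLowestTerms θ r s ∧
      a ^ 2 + b ^ 2 - 2 * (s : ℚ) / (r : ℚ) * (a * b) = c ^ 2 ∧
      a ^ 2 + d ^ 2 + 2 * (s : ℚ) / (r : ℚ) * (a * d) = e ^ 2 ∧
      a * (b + d) = (r : ℚ) * (n : ℚ)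

/-- The set of all rational `θ`-parallelogram envelopes for `n`, as quintuples. -/
def parallelogramEnvelopes (θ : ℝ) (n : ℕ) : Set (ℚ × ℚ × ℚ × ℚ × ℚ) :=
  {x | IsParallelogramEnvelope θ n x.1 x.2.1 x.2.2.1 x.2.2.2.1 x.2.2.2.2}

/-- The set `N_θ` of positive integers that have a rational `θ`-parallelogram envelope. -/
def envelopeNumbers (θ : ℝ) : Set ℕ :=
  {n | ∃ a b c d e : ℚ, IsParallelogramEnvelope θ n a b c d e}

/-- The set `N_{θ,m}` of positive integers that have a rational `θ`-parallelogram envelope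
with ratio `m`, that is, with `d = m b`. -/
def envelopeNumbersWithRatio (θ : ℝ) (m : ℚ) : Set ℕ :=
  {n | ∃ a b c d e : ℚ, IsParallelogramEnvelope θ n a b c d e ∧ d = m * b}

/-! Scale so that `a = 1`, with `b = x`, `d = y`. Each norm equation is then a conic with a rational
parametrisation, by `t` for `x` and `u` for `y`. The area condition asks that `R / (x + y)` be a
rational square, which gives the surface `t u (t + u) (t u - 1) = k w ^ 2` with `k = 2 R / S`. On `u
= c t ^ 2` with `c = k j ^ 2` this reduces to making the quartic `(1 + c t) (c t ^ 3 - 1)` a square.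
Its leading coefficient is `c ^ 2`, so completing the square leaves a linear equation for `t`, whose
solution has a pole at `8 c ^ 2 = 1`. Density of `ℚ` lets `c` approach the pole, so `t` and `u / t`
are unbounded, and so is `d / b`. This gives existence and both infinitude claims. -/

/-- Rational numbers `j` for which `8 (k j ^ 2) ^ 2` lies just below `1`. -/
lemma exists_rat_sq_near (k δ : ℚ) (hk : 0 < k) (hδ : 0 < δ) (hδ1 : δ < 1) :
    ∃ j : ℚ, 0 < 1 - 8 * (k * j ^ 2) ^ 2 ∧ 1 - 8 * (k * j ^ 2) ^ 2 < δ := by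
  let f : ℝ → ℝ := fun x => 1 - 8 * ((k : ℝ) * x ^ 2) ^ 2
  have hf : Continuous f := by fun_prop
  have hk' : (0 : ℝ) < k := by exact_mod_cast hk
  have hδ' : (0 : ℝ) < δ := by exact_mod_cast hδ
  have hδ1' : (δ : ℝ) < 1 := by exact_mod_cast hδ1
  have hne : (f ⁻¹' Set.Ioo 0 (δ : ℝ)).Nonempty := by
    refine ⟨√(√((1 - δ / 2) / 8) / k), ?_⟩
    have h : f √(√((1 - δ / 2) / 8) / k) = δ / 2 := by
      simp only [f]
      rw [Real.sq_sqrt (by positivity), mul_div_cancel₀ _ hk'.ne', Real.sq_sqrt (by linarith)]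
      ring
    rw [Set.mem_preimage, h]
    exact ⟨by linarith, by linarith⟩
  obtain ⟨j, hj⟩ := (Rat.denseRange_cast (𝕜 := ℝ)).exists_mem_open (isOpen_Ioo.preimage hf) hne
  obtain ⟨h1, h2⟩ := hj
  simp only [f] at h1 h2
  exact ⟨j, by exact_mod_cast h1, by exact_mod_cast h2⟩

/-- The surface `t u (t + u) (t u - 1) = k w ^ 2` has rational points with `t` and `u / t`
arbitrarily large, found on the curves `u = k j ^ 2 * t ^ 2`. -/
lemma exists_rat_point_large (k N : ℚ) (hk : 0 < k) (hN : 1 ≤ N) :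
    ∃ t u w : ℚ, N < t ∧ N * t < u ∧ 0 < w ∧
      t * u * (t + u) * (t * u - 1) = k * w ^ 2 := by
  have hNpos : 0 < N := by linarith
  -- The tolerance `1 / (32 N)` forces `t > 4 N` below; with `c > 1 / 4` this gives `u / t = c t >
  -- N`.
  obtain ⟨j, h0, h1⟩ := exists_rat_sq_near k (1 / (32 * N)) hk (by positivity)
    (by rw [div_lt_one (by positivity)]; linarith)
  obtain ⟨c, hc⟩ : ∃ c, c = k * j ^ 2 := ⟨_, rfl⟩
  rw [← hc] at h0 h1
  obtain ⟨ε, hε⟩ : ∃ ε, ε = 1 - 8 * c ^ 2 := ⟨_, rfl⟩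
  rw [← hε] at h0 h1
  have hc0 : 0 ≤ c := by rw [hc]; positivity
  rw [lt_div_iff₀ (by positivity)] at h1
  have hε2 : ε < 1 / 32 := by nlinarith
  have hc4 : 1 / 4 < c := by nlinarith
  have hc1 : c < 1 := by nlinarith
  -- In `(c t ^ 2 + t / 2 + β) ^ 2` the top two coefficients match the quartic, and `β = -1 / (8 c)`
  -- removes the `t ^ 2` term. Equating what remains is linear in `t`, with this root.
  obtain ⟨t, ht⟩ : ∃ t, t = (64 * c ^ 2 + 1) / (8 * c * ε) := ⟨_, rfl⟩
  have ht4 : 4 * N < t := by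
    rw [ht, lt_div_iff₀ (by positivity)]
    nlinarith [mul_pos hNpos h0, mul_nonneg (mul_pos hNpos h0).le (sub_nonneg.2 hc1.le)]
  have htpos : 0 < t := by linarith
  have hu : N * t < c * t ^ 2 := by
    have : N < c * t := by nlinarith
    nlinarith
  have key : (1 + c * t) * (c * t ^ 3 - 1) = (c * t ^ 2 + t / 2 - 1 / (8 * c)) ^ 2 := by
    have h : t * (1 - 8 * c ^ 2) * (8 * c) = 64 * c ^ 2 + 1 := by
      rw [ht, ← hε]; field_simp
    obtain ⟨i, hi⟩ : ∃ i, i = 1 / (8 * c) := ⟨_, rfl⟩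
    have hci : 8 * c * i = 1 := by rw [hi]; field_simp
    rw [← hi]
    linear_combination i ^ 2 * h + (t ^ 2 / 4 - t * i + (c * t + 1) * (8 * c * i + 1)) * hci
  obtain ⟨P, hP⟩ : ∃ P, P = c * t ^ 2 + t / 2 - 1 / (8 * c) := ⟨_, rfl⟩
  have hw : t * (c * t ^ 2) * (t + c * t ^ 2) * (t * (c * t ^ 2) - 1)
      = k * |j * t ^ 2 * P| ^ 2 := by
    rw [← hP] at key
    rw [sq_abs]
    linear_combination (c * t ^ 4) * key + t ^ 4 * P ^ 2 * hc
  refine ⟨t, c * t ^ 2, |j * t ^ 2 * P|, by linarith, hu, ?_, hw⟩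
  -- `w = 0` would make the left side of `hw` vanish, but all its factors are positive.
  rw [abs_pos]
  intro h
  rw [h] at hw
  have h2 : 0 < t * (c * t ^ 2) - 1 := by nlinarith
  have : 0 < t * (c * t ^ 2) * (t + c * t ^ 2) * (t * (c * t ^ 2) - 1) := by positivity
  simp [hw] at this

/-- For a rational point `(C, S)` of the upper unit half circle there are positive rational
solutions of the envelope equations with `d / b` arbitrarily large. -/
lemma exists_rat_envelope (C S R M : ℚ) (hCS : C ^ 2 + S ^ 2 = 1) (hS : 0 < S) (hR : 0 < R)
    (hM : 1 ≤ M) :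
    ∃ a b c d e : ℚ, 0 < a ∧ 0 < b ∧ 0 < c ∧ 0 < d ∧ 0 < e ∧
      a ^ 2 + b ^ 2 - 2 * C * (a * b) = c ^ 2 ∧
      a ^ 2 + d ^ 2 + 2 * C * (a * d) = e ^ 2 ∧
      a * (b + d) = R ∧ M * b ≤ d := by
  have hM0 : 0 < M := by linarith
  have hC : |C| < 1 := by
    rw [← sq_lt_one_iff_abs_lt_one]; nlinarith
  obtain ⟨hC1, hC2⟩ := abs_lt.1 hC
  -- The summand `2 (M + 1) / S` absorbs the bounded terms `±C`, `t⁻¹`, `u⁻¹`, so that `x > 0` and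
  -- `y ≥ M x`.
  obtain ⟨t, u, w, ht, hu, hw, h⟩ := exists_rat_point_large (2 * R / S)
    (M + 1 + 2 * (M + 1) / S) (by positivity)
    (by have : 0 < 2 * (M + 1) / S := by positivity
        linarith)
  obtain ⟨q, hq⟩ : ∃ q, q = (M + 1) / S := ⟨_, rfl⟩
  have hq0 : 0 < q := by rw [hq]; positivity
  have hqS : S * q = M + 1 := by rw [hq]; field_simp
  rw [mul_div_assoc, ← hq] at ht hu
  have ht1 : 1 < t := by linarith
  have ht0 : 0 < t := by linarith
  have hu1 : 1 < u := by nlinarith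
  have hu0 : 0 < u := by linarith
  have hti : t⁻¹ < 1 := inv_lt_one_of_one_lt₀ ht1
  have hti0 : 0 < t⁻¹ := inv_pos.2 ht0
  have hui : u⁻¹ < 1 := inv_lt_one_of_one_lt₀ hu1
  -- Since `C ^ 2 + S ^ 2 = 1`, the conic is `(x - C) ^ 2 + S ^ 2 = z ^ 2`, parametrised by `z ± (x
  -- - C) = S t ^ (±1)`; for `y` replace `C` by `-C`.
  obtain ⟨x, hx⟩ : ∃ x, x = C + S * (t - t⁻¹) / 2 := ⟨_, rfl⟩
  obtain ⟨y, hy⟩ : ∃ y, y = -C + S * (u - u⁻¹) / 2 := ⟨_, rfl⟩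
  have hx0 : 0 < x := by
    have h1 : 2 * q < t - t⁻¹ := by linarith
    have h2 : S * (2 * q) < S * (t - t⁻¹) := mul_lt_mul_of_pos_left h1 hS
    rw [hx]; linarith
  have hxt : x ≤ 1 + S * t / 2 := by
    have : 0 < S * t⁻¹ := by positivity
    rw [hx]; linarith
  have hyx : M * x ≤ y := by
    have h1 : S * (M * t + 2 * q * t) < S * (u - u⁻¹) :=
      mul_lt_mul_of_pos_left (by nlinarith) hS
    have h2 : M * x ≤ M * (1 + S * t / 2) := mul_le_mul_of_nonneg_left hxt hM0.le
    have h3 : S * (q * t) = (M + 1) * t := by rw [← mul_assoc, hqS]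
    have h4 : (M + 1) * 1 ≤ (M + 1) * t := mul_le_mul_of_nonneg_left ht1.le (by linarith)
    rw [hy]; linarith
  have hy0 : 0 < y := lt_of_lt_of_le (by positivity) hyx
  have hxy : (t * u) ^ 2 * (x + y) = R * w ^ 2 := by
    rw [hx, hy]
    field_simp at h ⊢
    -- Here `x + y = S (t + u) (t u - 1) / (2 t u)`, so this is the surface equation; hence the
    -- scale `t u / w` yields area `R`.
    linear_combination h
  refine ⟨t * u / w, t * u / w * x, t * u / w * (S * (t + t⁻¹) / 2), t * u / w * y,
    t * u / w * (S * (u + u⁻¹) / 2), by positivity, by positivity, by positivity, by positivity,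
    by positivity, ?_, ?_, ?_, ?_⟩
  · have : 1 + x ^ 2 - 2 * C * x = (S * (t + t⁻¹) / 2) ^ 2 := by
      have : t * t⁻¹ = 1 := mul_inv_cancel₀ ht0.ne'
      rw [hx]; linear_combination -hCS - S ^ 2 * this
    linear_combination (t * u / w) ^ 2 * this
  · have : 1 + y ^ 2 + 2 * C * y = (S * (u + u⁻¹) / 2) ^ 2 := by
      have : u * u⁻¹ = 1 := mul_inv_cancel₀ hu0.ne'
      rw [hy]; linear_combination -hCS - S ^ 2 * this
    linear_combination (t * u / w) ^ 2 * this
  · field_simp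
    linear_combination hxy
  · have : 0 < t * u / w := by positivity
    nlinarith [mul_le_mul_of_nonneg_left hyx this.le]

/-- A Pythagorean angle has envelopes for every `n > 0`, with arbitrarily large ratio `d / b`. -/
lemma IsPythagoreanAngle.exists_envelope {θ : ℝ} (hθ : IsPythagoreanAngle θ) {n : ℕ} (hn : 0 < n)
    {M : ℚ} (hM : 1 ≤ M) :
    ∃ a b c d e : ℚ, IsParallelogramEnvelope θ n a b c d e ∧ M * b ≤ d := by
  obtain ⟨h0, hπ, ⟨C, hC⟩, ⟨S, hS⟩⟩ := hθ
  have hS0 : 0 < S := by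
    have := Real.sin_pos_of_pos_of_lt_pi h0 hπ
    rw [hS] at this
    exact_mod_cast this
  have hCS : C ^ 2 + S ^ 2 = 1 := by
    have := Real.cos_sq_add_sin_sq θ
    rw [hC, hS] at this
    exact_mod_cast this
  have hden : (0 : ℚ) < C.den := by exact_mod_cast C.den_pos
  have hlow : IsCosineInLowestTerms θ C.den C.num := by
    refine ⟨?_, ?_, ?_⟩
    · have : |C| < 1 := by rw [← sq_lt_one_iff_abs_lt_one]; nlinarith
      rw [← Rat.num_div_den C, abs_div, abs_of_pos hden, div_lt_one hden] at this
      exact_mod_cast this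
    · rw [Int.gcd_comm]
      simpa [Int.gcd, Nat.Coprime, Nat.gcd_comm] using C.reduced
    · rw [hC]
      exact_mod_cast congrArg (Rat.cast (K := ℝ)) (Rat.num_div_den C).symm
  obtain ⟨a, b, c, d, e, ha, hb, hc, hd, he, h1, h2, h3, h4⟩ :=
    exists_rat_envelope C S (C.den * n) M hCS hS0 (by positivity) hM
  have hCe : 2 * (C.num : ℚ) / ((C.den : ℤ) : ℚ) = 2 * C := by
    rw [mul_div_assoc, Int.cast_natCast, Rat.num_div_den]
  refine ⟨a, b, c, d, e, ⟨hn, ha, hb, hc, hd, he, C.den, C.num, hlow, ?_, ?_, ?_⟩, h4⟩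
  · rw [hCe, h1]
  · rw [hCe, h2]
  · rw [h3, Int.cast_natCast]

/-- The ratios `d / b` that occur exceed any bound, so they cannot form a finite set. -/
lemma IsPythagoreanAngle.infinite_ratios {θ : ℝ} (hθ : IsPythagoreanAngle θ) {n : ℕ}
    (hn : 0 < n) : {m : ℚ | 1 ≤ m ∧ n ∈ envelopeNumbersWithRatio θ m}.Infinite := by
  refine Set.infinite_of_not_bddAbove ?_
  rintro ⟨B, hB⟩
  obtain ⟨a, b, c, d, e, h, hM⟩ := hθ.exists_envelope hn (le_max_left 1 (B + 1))
  have hb : 0 < b := h.2.2.1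
  have hdb : max 1 (B + 1) ≤ d / b := (le_div_iff₀ hb).2 hM
  have := hB ⟨(le_max_left _ _).trans hdb, a, b, c, d, e, h, (div_mul_cancel₀ d hb.ne').symm⟩
  linarith [(le_max_right 1 (B + 1)).trans hdb]

theorem mainTheorem1 (θ : ℝ) (hθ : IsPythagoreanAngle θ) (hθ' : θ ≤ Real.pi / 2) :
    envelopeNumbers θ = {n : ℕ | 0 < n} ∧
    (∀ n ∈ envelopeNumbers θ, (parallelogramEnvelopes θ n).Infinite) ∧
    (∀ n ∈ envelopeNumbers θ,
      {m : ℚ | 1 ≤ m ∧ n ∈ envelopeNumbersWithRatio θ m}.Infinite) := by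
  have hpos : ∀ n ∈ envelopeNumbers θ, 0 < n := by
    rintro n ⟨a, b, c, d, e, h⟩
    exact h.1
  refine ⟨Set.Subset.antisymm hpos fun n hn => ?_, fun n hn => ?_,
    fun n hn => hθ.infinite_ratios (hpos n hn)⟩
  · obtain ⟨a, b, c, d, e, h, -⟩ := hθ.exists_envelope hn le_rfl
    exact ⟨a, b, c, d, e, h⟩
  -- The map sending an envelope to `d / b` has infinite image, so there are infinitely many
  -- envelopes.
  · refine Set.Infinite.of_image (fun x => x.2.2.2.1 / x.2.1)
      ((hθ.infinite_ratios (hpos n hn)).mono ?_)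
    rintro m ⟨-, a, b, c, d, e, h, hd⟩
    refine ⟨(a, b, c, d, e), h, ?_⟩
    have hb : 0 < b := h.2.2.1
    simp only [hd]
    exact mul_div_cancel_right₀ m hb.ne'
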